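/- Let $G$ be a connected simple complex Lie group of rank $r$ with Chevalley generators $h_i,x_i^{\pm}$ ($1\le i\le r$) of its Lie algebra and Cartan matrix $\mathrm C$, so that $[h_i,x_j^{\pm}]=\pm \mathrm C_{ij}x_j^{\pm}$ and $[x_i^+,x_j^-]=\delta_{ij}h_i$. Let $\phi_i:SL_2(\mathbb C)\to G$ be the homomorphism whose differential sends the standard basis of $\mathfrak{sl}_2$ to $x_i^+,h_i,x_i^-$, and let $h^1,\dots,h^r$ be the basis of the Cartan subalgebra with $h_j=\sum_i \mathrm C_{ji}h^i$. Let $w=s_{i_1}\cdots s_{i_r}$ be a Coxeter element of the Weyl group, i.e. $(i_1,\dots,i_r)$ is an ordering of $\{1,\dots,r\}$. For $i=i_\beta$ put $\{i\}_+=\{i_\alpha:\alpha>\beta\}$ and $\{i\}_-=\{i_\alpha:\alpha<\beta\}$. For $A_i,B_i,C_i,D_i\in\mathbb C^\times$ ($1\le i\le r$), the coordinates on the Zariski open part of the Coxeter symplectic leaf attached to this word, let $$U_i=\phi_i\begin{pmatrix}A_i&B_i\\0&A_i^{-1}\end{pmatrix},\qquad L_i=\phi_i\begin{pmatrix}D_i&0\\C_i&D_i^{-1}\end{pmatrix},\qquad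 UL^{-1}=U_{i_1}\cdots U_{i_r}\,L_{i_1}^{-1}\cdots L_{i_r}^{-1},$$ $$V_i=B_iA_i\prod_{j\in\{i\}_-}A_j^{\mathrm C_{ji}},\qquad W_i=C_iD_i^{-1}\prod_{j\in\{i\}_+}D_j^{-\mathrm C_{ji}},\qquad \chi_i^+=V_iW_i,\qquad \chi_i^-=\chi_i^+\prod_j\Big(\frac{A_j}{D_j}\Big)^{-\mathrm C_{ji}}.$$ Choose $a_j\in\mathbb C$ with $e^{a_j}=A_j/D_j$ and put $t_i=\sum_j \mathrm C_{ji}a_j$. Then $e^{t_i}=\chi_i^+/\chi_i^-$. With respect to these logarithms let $\prod_j(\chi_j^+/\chi_j^-)^{h^j}:=\prod_j\exp(t_jh^j)\in G$. Then for every finite-dimensional holomorphic representation $V$ of $G$, with character $\mathrm{Ch}_V(g)=\mathrm{Tr}_V(g)$, $$\mathrm{Ch}_V(UL^{-1})=\mathrm{Ch}_V\Big(\prod_{j=1}^r\Big(\frac{\chi_j^+}{\chi_j^-}\Big)^{h^j}\phi_{i_1}(g_{i_1})\cdots\phi_{i_r}(g_{i_r})\Big)=\mathrm{Ch}_V\Big(\prod_{j=1}^r\Big(\frac{\chi_j^+}{\chi_j^-}\Big)^{h^j}\phi_{i_1}(\bar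 g_{i_1})\cdots\phi_{i_r}(\bar g_{i_r})\Big),$$ where $$g_i=\begin{pmatrix}1-\chi_i^-&\chi_i^-\\-1&1\end{pmatrix},\qquad \bar g_i=\begin{pmatrix}1&\chi_i^+\\-1&1-\chi_i^+\end{pmatrix}.$$ -/

import Mathlib

open scoped Manifold ContDiff MatrixGroups

noncomputable section

namespace CoxeterToda

/-! ### Coordinates attached to a Coxeter word

`K` is the Cartan matrix, with the convention `[h_i, x_j^±] = ± K i j • x_j^±`. A Coxeter element
`w = s_{i_1} ⋯ s_{i_r}` is given by the word `i = (i_1, …, i_r)`, in which every node of the Dynkin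
diagram occurs exactly once, i.e. by a permutation `i` of the set of nodes `Fin r`. -/

/-- `{n}_+`: the letters of the word that stand to the right of the letter `n`. -/
def lettersAfter {r : ℕ} (i : Equiv.Perm (Fin r)) (n : Fin r) : Finset (Fin r) :=
  Finset.univ.filter fun m => i.symm n < i.symm m

/-- `{n}_-`: the letters of the word that stand to the left of the letter `n`. -/
def lettersBefore {r : ℕ} (i : Equiv.Perm (Fin r)) (n : Fin r) : Finset (Fin r) :=
  Finset.univ.filter fun m => i.symm m < i.symm n

/-- `V_n = B_n A_n ∏_{m ∈ {n}_-} A_m ^ K_{mn}`. -/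
def coordV {r : ℕ} (K : Matrix (Fin r) (Fin r) ℤ) (i : Equiv.Perm (Fin r))
    (A B : Fin r → ℂˣ) (n : Fin r) : ℂˣ :=
  B n * A n * ∏ m ∈ lettersBefore i n, A m ^ K m n

/-- `W_n = C_n D_n⁻¹ ∏_{m ∈ {n}_+} D_m ^ (-K_{mn})`. -/
def coordW {r : ℕ} (K : Matrix (Fin r) (Fin r) ℤ) (i : Equiv.Perm (Fin r))
    (C D : Fin r → ℂˣ) (n : Fin r) : ℂˣ :=
  C n * (D n)⁻¹ * ∏ m ∈ lettersAfter i n, D m ^ (-K m n)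

/-- `χ⁺_n = V_n W_n`. -/
def chiPlus {r : ℕ} (K : Matrix (Fin r) (Fin r) ℤ) (i : Equiv.Perm (Fin r))
    (A B C D : Fin r → ℂˣ) (n : Fin r) : ℂˣ :=
  coordV K i A B n * coordW K i C D n

/-- `χ⁻_n = χ⁺_n ∏_m (A_m / D_m) ^ (-K_{mn})`. -/
def chiMinus {r : ℕ} (K : Matrix (Fin r) (Fin r) ℤ) (i : Equiv.Perm (Fin r))
    (A B C D : Fin r → ℂˣ) (n : Fin r) : ℂˣ :=
  chiPlus K i A B C D n * ∏ m, (A m / D m) ^ (-K m n)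

/-! ### Elements of `SL₂` -/

/-- The matrix `(a b; 0 a⁻¹)`. -/
def upperSL (a : ℂˣ) (b : ℂ) : SL(2, ℂ) :=
  ⟨!![(a : ℂ), b; 0, (a : ℂ)⁻¹], by simp [Matrix.det_fin_two_of]⟩

/-- The matrix `(d 0; c d⁻¹)`. -/
def lowerSL (d : ℂˣ) (c : ℂ) : SL(2, ℂ) :=
  ⟨!![(d : ℂ), 0; c, (d : ℂ)⁻¹], by simp [Matrix.det_fin_two_of]⟩

/-- The matrix `g = (1 - χ⁻ χ⁻; -1 1)`. -/
def gMinus (χ : ℂ) : SL(2, ℂ) :=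
  ⟨!![1 - χ, χ; -1, 1], by simp [Matrix.det_fin_two_of]⟩

/-- The matrix `ḡ = (1 χ⁺; -1 1 - χ⁺)`. -/
def gPlus (χ : ℂ) : SL(2, ℂ) :=
  ⟨!![1, χ; -1, 1 - χ], by simp [Matrix.det_fin_two_of]⟩

/-- The nonzero complex number `exp z`. -/
def expUnit (z : ℂ) : ℂˣ := Units.mk0 (Complex.exp z) (Complex.exp_ne_zero z)

/-! ### Complex Lie groups -/

section LieGroup

variable {E : Type*} [NormedAddCommGroup E] [NormedSpace ℂ E]
  {G : Type*} [TopologicalSpace G] [ChartedSpace E G] [Group G]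

/-- `γ` is the complex one-parameter subgroup `z ↦ exp (z x)` of `G` generated by the vector `x`
of the Lie algebra. -/
def IsOneParameterSubgroup (γ : ℂ → G) (x : GroupLieAlgebra 𝓘(ℂ, E) G) : Prop :=
  (∀ s t, γ (s + t) = γ s * γ t) ∧
    HasMFDerivAt 𝓘(ℂ, ℂ) 𝓘(ℂ, E) γ 0 (ContinuousLinearMap.toSpanSingleton ℂ (show E from x))

/-- `φ : SL₂(ℂ) → G` is the homomorphism whose differential sends the standard basis
`(0 1; 0 0)`, `(1 0; 0 -1)`, `(0 0; 1 0)` of `sl₂` to `e`, `h`, `f`. As `SL₂(ℂ)` is generated by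
unipotent triangular matrices, `φ` is determined by `e` and `f`. -/
structure IsSL2Hom (φ : SL(2, ℂ) →* G) (h e f : GroupLieAlgebra 𝓘(ℂ, E) G) : Prop where
  map_e : IsOneParameterSubgroup (fun z => φ (upperSL 1 z)) e
  map_h : IsOneParameterSubgroup (fun z => φ (upperSL (expUnit z) 0)) h
  map_f : IsOneParameterSubgroup (fun z => φ (lowerSL 1 z)) f

/-- A representation of a complex Lie group is holomorphic if all its matrix coefficients are. -/
def IsHolomorphicRep (E : Type*) [NormedAddCommGroup E] [NormedSpace ℂ E]
    {G : Type*} [TopologicalSpace G] [ChartedSpace E G] [Group G]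
    {V : Type*} [AddCommGroup V] [Module ℂ V] (ρ : Representation ℂ G V) : Prop :=
  ∀ (v : V) (l : Module.Dual ℂ V), ContMDiff 𝓘(ℂ, E) 𝓘(ℂ, ℂ) ω fun g => l (ρ g v)

end LieGroup

/-- The product `x_{i_1} ⋯ x_{i_r}` in the order prescribed by the word `i`. -/
def wordProd {G : Type*} [Group G] {r : ℕ} (i : Equiv.Perm (Fin r)) (x : Fin r → G) : G :=
  (List.ofFn fun k => x (i k)).prod

/-- The element `U L⁻¹ = U_{i_1} ⋯ U_{i_r} L_{i_1}⁻¹ ⋯ L_{i_r}⁻¹` of `G`, where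
`U_n = φ_n (A_n B_n; 0 A_n⁻¹)` and `L_n = φ_n (D_n 0; C_n D_n⁻¹)`. -/
def coxeterElement {G : Type*} [Group G] {r : ℕ} (φ : Fin r → SL(2, ℂ) →* G)
    (i : Equiv.Perm (Fin r)) (A B C D : Fin r → ℂˣ) : G :=
  wordProd i (fun n => φ n (upperSL (A n) (B n))) *
    wordProd i (fun n => (φ n (lowerSL (D n) (C n)))⁻¹)

section LieAlgebra

variable {L : Type*} [LieRing L] [LieAlgebra ℂ L] {H : LieSubalgebra ℂ L} {r : ℕ}

/-- The Cartan matrix of a system of Chevalley generators `h_n`, `x_n^+ = e_n`, `x_n^- = f_n`,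
normalised by `[h_m, x_n^±] = ± K m n • x_n^±`. -/
def cartanMat (b : LieAlgebra.Basis (Fin r) H) : Matrix (Fin r) (Fin r) ℤ := b.A.transpose

/-- The basis `h^n` of the Cartan subalgebra determined by `h_m = ∑_n K m n • h^n`. -/
def fundCoweight (b : LieAlgebra.Basis (Fin r) H) (n : Fin r) : L :=
  ∑ m, ((cartanMat b).map (Int.cast : ℤ → ℂ))⁻¹ n m • b.h m

end LieAlgebra

end CoxeterToda

end

/-! A character sees only the image of `G` in `End V`, and there every one-parameter subgroup is a
power-series exponential. The differential of the representation preserves brackets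
(`differentialAtOne_lie`), so the Chevalley relations become relations between exponentials: the
torus rescales root elements, and `E_m`, `F_n` commute for `m ≠ n`. `rootRelations_toHomUnits`
proves these relations; the rest is group theory.

Push the torus parts of the `U`'s to the right and those of the `L⁻¹`'s to the left. The result is
`∏ E_n(V_n) · T t · ∏ F_n(-W_n)`; the rescalings met on the way are exactly the monomials in `V_n`
and `W_n`. Moving `T t` to the far left replaces `V_n` by `exp (-t_n) V_n`, and commutation of
distinct letters merges the two products into `∏ E_n F_n`. Conjugation by a torus element that
scales `E_n` by `W_n` leaves `T t` and the trace alone, and gives `E_n(χ⁻_n) F_n(-1)`, the image of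
`gMinus`. Rotating the trace first, so that the `F`'s precede the `E`'s, gives `gPlus` with `χ⁺_n`
instead. -/

noncomputable section

namespace CoxeterToda

/-! ### Lie brackets of vector fields as commutators of derivations -/

section Manifold

open VectorField Set Filter Topology

variable {E : Type*} [NormedAddCommGroup E] [NormedSpace ℂ E]
  {F : Type*} [NormedAddCommGroup F] [NormedSpace ℂ F]
  {M : Type*} [TopologicalSpace M] [ChartedSpace E M] [IsManifold 𝓘(ℂ, E) ω M]

/-- In the preferred chart, the derivative of a function along the pullback of a vector field is
its derivative along the vector field. -/
lemma fderiv_comp_extChartAt_symm_mpullback {f : M → F} {x : M} {y : E}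
    (hy : y ∈ (extChartAt 𝓘(ℂ, E) x).target)
    (hf : MDifferentiableAt 𝓘(ℂ, E) 𝓘(ℂ, F) f ((extChartAt 𝓘(ℂ, E) x).symm y))
    (V : Π p : M, TangentSpace 𝓘(ℂ, E) p) :
    fderiv ℂ (f ∘ (extChartAt 𝓘(ℂ, E) x).symm) y
        (mpullback 𝓘(ℂ, E) 𝓘(ℂ, E) (extChartAt 𝓘(ℂ, E) x).symm V y) =
      mfderiv 𝓘(ℂ, E) 𝓘(ℂ, F) f ((extChartAt 𝓘(ℂ, E) x).symm y)
        (V ((extChartAt 𝓘(ℂ, E) x).symm y)) := by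
  have hinv : (mfderiv 𝓘(ℂ, E) 𝓘(ℂ, E) (extChartAt 𝓘(ℂ, E) x).symm y).IsInvertible := by
    have : IsManifold 𝓘(ℂ, E) 1 M := .of_le (n := ω) le_top
    simpa using isInvertible_mfderivWithin_extChartAt_symm (I := 𝓘(ℂ, E)) hy
  have hd := mdifferentiableAt_of_isInvertible_mfderiv hinv
  rw [← mfderiv_eq_fderiv, mfderiv_comp y hf hd]
  rw [mpullback_apply]
  change mfderiv 𝓘(ℂ, E) 𝓘(ℂ, F) f ((extChartAt 𝓘(ℂ, E) x).symm y)
    (mfderiv 𝓘(ℂ, E) 𝓘(ℂ, E) (extChartAt 𝓘(ℂ, E) x).symm y _) = _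
  congr 1
  obtain ⟨e, he⟩ := hinv
  rw [← he, ContinuousLinearMap.inverse_equiv]
  exact e.apply_symm_apply _

/-- The derivative of a function along the Lie bracket of two vector fields is the commutator of
its derivatives along them. -/
lemma mfderiv_mlieBracket [CompleteSpace E] {f v w : M → F} {x : M} {V W : Π p : M, TangentSpace 𝓘(ℂ, E) p}
    (hf : ContMDiff 𝓘(ℂ, E) 𝓘(ℂ, F) ω f)
    (hV : MDifferentiableAt 𝓘(ℂ, E) 𝓘(ℂ, E).tangent
      (fun p => (V p : TangentBundle 𝓘(ℂ, E) M)) x)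
    (hW : MDifferentiableAt 𝓘(ℂ, E) 𝓘(ℂ, E).tangent
      (fun p => (W p : TangentBundle 𝓘(ℂ, E) M)) x)
    (hv : MDifferentiable 𝓘(ℂ, E) 𝓘(ℂ, F) v) (hw : MDifferentiable 𝓘(ℂ, E) 𝓘(ℂ, F) w)
    (hfV : ∀ p, mfderiv 𝓘(ℂ, E) 𝓘(ℂ, F) f p (V p) = v p)
    (hfW : ∀ p, mfderiv 𝓘(ℂ, E) 𝓘(ℂ, F) f p (W p) = w p)
    {a b : F} (ha : mfderiv 𝓘(ℂ, E) 𝓘(ℂ, F) w x (V x) = a)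
    (hb : mfderiv 𝓘(ℂ, E) 𝓘(ℂ, F) v x (W x) = b) :
    mfderiv 𝓘(ℂ, E) 𝓘(ℂ, F) f x (mlieBracket 𝓘(ℂ, E) V W x) = a - b := by
  have i1 : IsManifold 𝓘(ℂ, E) 1 M := .of_le (n := ω) le_top
  have i2 : IsManifold 𝓘(ℂ, E) 2 M := .of_le (n := ω) le_top
  set c := extChartAt 𝓘(ℂ, E) x with hc
  have hx : c x ∈ c.target := mem_extChartAt_target x
  have hxx : c.symm (c x) = x := extChartAt_to_inv x
  have hmd := hf.mdifferentiable (by simp)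
  let V' : E → E := mpullback 𝓘(ℂ, E) 𝓘(ℂ, E) c.symm V
  let W' : E → E := mpullback 𝓘(ℂ, E) 𝓘(ℂ, E) c.symm W
  have hd : ∀ {U : Π p : M, TangentSpace 𝓘(ℂ, E) p}, MDifferentiableAt 𝓘(ℂ, E) 𝓘(ℂ, E).tangent
      (fun p => (U p : TangentBundle 𝓘(ℂ, E) M)) x →
      DifferentiableAt ℂ (fun y => (mpullback 𝓘(ℂ, E) 𝓘(ℂ, E) c.symm U y : E)) (c x) := by
    intro U hU
    have h := (hU.mdifferentiableWithinAt (s := univ)).differentiableWithinAt_mpullbackWithin_vectorField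
    rw [ModelWithCorners.range_eq_univ, mpullbackWithin_univ, preimage_univ, inter_univ] at h
    exact differentiableWithinAt_univ.1 h
  have hcs : ContMDiffAt 𝓘(ℂ, E) 𝓘(ℂ, E) ω c.symm (c x) :=
    (contMDiffOn_extChartAt_symm x).contMDiffAt (extChartAt_target_mem_nhds x)
  have dp : ContDiffAt ℂ ω (f ∘ c.symm) (c x) := by
    rw [← contMDiffAt_iff_contDiffAt]
    exact (hf _).comp _ hcs
  -- In the chart the claim is the symmetry of the second derivative of `f`.
  have key := fderiv_apply_lieBracket (V := V') (W := W') dp le_top (hd hW) (hd hV)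
  let Z : E := lieBracket ℂ V' W' (c x)
  have hB : mlieBracket 𝓘(ℂ, E) V W x = (mfderiv 𝓘(ℂ, E) 𝓘(ℂ, E) c x).inverse Z := by
    rw [← mlieBracketWithin_univ, mlieBracketWithin, preimage_univ, univ_inter,
      ModelWithCorners.range_eq_univ, mpullbackWithin_univ, mpullbackWithin_univ]
    exact congrFun (congrArg (mpullback 𝓘(ℂ, E) 𝓘(ℂ, E) c)
      (lieBracketWithin_univ (𝕜 := ℂ) (V := V') (W := W'))) x
  have hcomp : ∀ {u : M → F} {U : Π p : M, TangentSpace 𝓘(ℂ, E) p},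
      (∀ p, mfderiv 𝓘(ℂ, E) 𝓘(ℂ, F) f p (U p) = u p) →
      (fun y => fderiv ℂ (f ∘ c.symm) y (mpullback 𝓘(ℂ, E) 𝓘(ℂ, E) c.symm U y))
        =ᶠ[𝓝 (c x)] u ∘ c.symm := by
    intro u U h
    filter_upwards [extChartAt_target_mem_nhds (I := 𝓘(ℂ, E)) x] with y hy
    rw [fderiv_comp_extChartAt_symm_mpullback hy (hmd _)]
    exact h _
  rw [(hcomp hfW).fderiv_eq, (hcomp hfV).fderiv_eq,
    fderiv_comp_extChartAt_symm_mpullback hx (hw _),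
    fderiv_comp_extChartAt_symm_mpullback hx (hv _), hxx] at key
  rw [← ha, ← hb]
  refine Eq.trans ?_ key
  have hfc : mfderiv 𝓘(ℂ, E) 𝓘(ℂ, F) f x =
      (mfderiv 𝓘(ℂ, E) 𝓘(ℂ, F) (f ∘ c.symm) (c x)).comp (mfderiv 𝓘(ℂ, E) 𝓘(ℂ, E) c x) := by
    have hdc : MDifferentiableAt 𝓘(ℂ, E) 𝓘(ℂ, E) c x :=
      mdifferentiableAt_extChartAt (mem_chart_source _ x)
    refine Eq.trans ?_ (mfderiv_comp x (dp.differentiableAt (by simp)).mdifferentiableAt hdc)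
    apply Filter.EventuallyEq.mfderiv_eq
    filter_upwards [extChartAt_source_mem_nhds (I := 𝓘(ℂ, E)) x] with p hp
    exact congrArg f (c.left_inv hp).symm
  obtain ⟨e, he⟩ := isInvertible_mfderiv_extChartAt (mem_extChartAt_source (I := 𝓘(ℂ, E)) x)
  rw [← hc] at he
  have hZ : mfderiv 𝓘(ℂ, E) 𝓘(ℂ, E) c x (mlieBracket 𝓘(ℂ, E) V W x) = Z := by
    rw [hB, ← he, ContinuousLinearMap.inverse_equiv]
    exact e.apply_symm_apply _
  rw [← mfderiv_eq_fderiv]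
  exact (DFunLike.congr_fun hfc _).trans
    (congrArg (mfderiv 𝓘(ℂ, E) 𝓘(ℂ, F) (f ∘ c.symm) (c x)) hZ)

end Manifold

/-! ### Differentials of homomorphisms into a Banach algebra -/

section Differential

open NormedSpace

variable {E : Type*} [NormedAddCommGroup E] [NormedSpace ℂ E]
  {G : Type*} [TopologicalSpace G] [ChartedSpace E G]
  {𝔸 : Type*} [NormedRing 𝔸] [NormedAlgebra ℂ 𝔸]

lemma mfderiv_const_mul {f : G → 𝔸} {g : G} (a : 𝔸)
    (hf : MDifferentiableAt 𝓘(ℂ, E) 𝓘(ℂ, 𝔸) f g) (v : TangentSpace 𝓘(ℂ, E) g) :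
    mfderiv 𝓘(ℂ, E) 𝓘(ℂ, 𝔸) (fun p => a * f p) g v =
      a * (show 𝔸 from mfderiv 𝓘(ℂ, E) 𝓘(ℂ, 𝔸) f g v) := by
  have h1 : HasMFDerivAt 𝓘(ℂ, 𝔸) 𝓘(ℂ, 𝔸) (fun b : 𝔸 => a * b) (f g)
      (ContinuousLinearMap.mul ℂ 𝔸 a) :=
    (ContinuousLinearMap.mul ℂ 𝔸 a).hasFDerivAt.hasMFDerivAt
  exact DFunLike.congr_fun (h1.comp g hf.hasMFDerivAt).mfderiv v

lemma mfderiv_mul_const {f : G → 𝔸} {g : G} (a : 𝔸)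
    (hf : MDifferentiableAt 𝓘(ℂ, E) 𝓘(ℂ, 𝔸) f g) (v : TangentSpace 𝓘(ℂ, E) g) :
    mfderiv 𝓘(ℂ, E) 𝓘(ℂ, 𝔸) (fun p => f p * a) g v =
      (show 𝔸 from mfderiv 𝓘(ℂ, E) 𝓘(ℂ, 𝔸) f g v) * a := by
  have h1 : HasMFDerivAt 𝓘(ℂ, 𝔸) 𝓘(ℂ, 𝔸) (fun b : 𝔸 => b * a) (f g)
      ((ContinuousLinearMap.mul ℂ 𝔸).flip a) :=
    ((ContinuousLinearMap.mul ℂ 𝔸).flip a).hasFDerivAt.hasMFDerivAt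
  exact DFunLike.congr_fun (h1.comp g hf.hasMFDerivAt).mfderiv v

lemma mdifferentiable_mul_const {f : G → 𝔸} (a : 𝔸)
    (hf : MDifferentiable 𝓘(ℂ, E) 𝓘(ℂ, 𝔸) f) :
    MDifferentiable 𝓘(ℂ, E) 𝓘(ℂ, 𝔸) (fun p => f p * a) := by
  intro g
  exact (((ContinuousLinearMap.mul ℂ 𝔸).flip a).differentiableAt.mdifferentiableAt).comp g (hf g)

variable [Group G]

variable (E) in
/-- The differential at the identity of a homomorphism from a complex Lie group to the
multiplicative monoid of a Banach algebra. -/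
def differentialAtOne (π : G →* 𝔸) : GroupLieAlgebra 𝓘(ℂ, E) G →ₗ[ℂ] 𝔸 :=
  (mfderiv 𝓘(ℂ, E) 𝓘(ℂ, 𝔸) π 1).toLinearMap

lemma mfderiv_one_apply (π : G →* 𝔸) (x : GroupLieAlgebra 𝓘(ℂ, E) G) :
    mfderiv 𝓘(ℂ, E) 𝓘(ℂ, 𝔸) π 1 x = differentialAtOne E π x := rfl

/-- Differentiate `π (g * p) = π g * π p` in `p` at the identity. -/
lemma mfderiv_mulInvariantVectorField [LieGroup 𝓘(ℂ, E) ω G] {π : G →* 𝔸}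
    (hπ : MDifferentiable 𝓘(ℂ, E) 𝓘(ℂ, 𝔸) π) (x : GroupLieAlgebra 𝓘(ℂ, E) G) (g : G) :
    mfderiv 𝓘(ℂ, E) 𝓘(ℂ, 𝔸) π g (mulInvariantVectorField x g) =
      π g * differentialAtOne E π x := by
  have hL : MDifferentiableAt 𝓘(ℂ, E) 𝓘(ℂ, E) (fun p : G => g * p) 1 :=
    (contMDiff_mul_left (I := 𝓘(ℂ, E)) (n := ω)).mdifferentiable (by simp) 1
  have h1 : HasMFDerivAt 𝓘(ℂ, E) 𝓘(ℂ, 𝔸) π (g * 1) (mfderiv 𝓘(ℂ, E) 𝓘(ℂ, 𝔸) π g) := by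
    rw [mul_one]; exact (hπ g).hasMFDerivAt
  have h2 := (h1.comp (1 : G) hL.hasMFDerivAt).mfderiv
  have h3 : (π ∘ fun p : G => g * p) = fun p => π g * π p := by ext p; simp
  rw [h3] at h2
  rw [← mfderiv_one_apply]
  exact (DFunLike.congr_fun h2 x).symm.trans (mfderiv_const_mul (π g) (hπ 1) x)

/-- The differential of a holomorphic homomorphism sends the Lie bracket to the commutator. -/
lemma differentialAtOne_lie [CompleteSpace E] [LieGroup 𝓘(ℂ, E) ω G] {π : G →* 𝔸}
    (hπ : ContMDiff 𝓘(ℂ, E) 𝓘(ℂ, 𝔸) ω π) (x y : GroupLieAlgebra 𝓘(ℂ, E) G) :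
    differentialAtOne E π ⁅x, y⁆ =
      differentialAtOne E π x * differentialAtOne E π y -
        differentialAtOne E π y * differentialAtOne E π x := by
  have hd := hπ.mdifferentiable (by simp)
  have hM : IsManifold 𝓘(ℂ, E) ω G := inferInstance
  -- The derivative of `π` along the left-invariant field of `y` is `π` times a constant, so a
  -- second derivative at `1` multiplies the two differentials.
  have h1 : ∀ x y : GroupLieAlgebra 𝓘(ℂ, E) G,
      mfderiv 𝓘(ℂ, E) 𝓘(ℂ, 𝔸) (fun g => π g * differentialAtOne E π y) 1
        (mulInvariantVectorField x 1) = differentialAtOne E π x * differentialAtOne E π y := by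
    intro x y
    rw [mfderiv_mul_const _ (hd 1), mfderiv_mulInvariantVectorField hd]
    rw [map_one]
    exact congrArg (· * differentialAtOne E π y) (one_mul (differentialAtOne E π x))
  exact mfderiv_mlieBracket hπ (mdifferentiableAt_mulInvariantVectorField x)
    (mdifferentiableAt_mulInvariantVectorField y)
    (mdifferentiable_mul_const _ hd) (mdifferentiable_mul_const _ hd)
    (mfderiv_mulInvariantVectorField hd x) (mfderiv_mulInvariantVectorField hd y)
    (h1 x y) (h1 y x)

/-- A differentiable homomorphism from the additive group of complex numbers to a Banach algebra
is an exponential. -/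
lemma eq_exp_of_hasDerivAt_zero [CompleteSpace 𝔸] {u : ℂ → 𝔸} {X : 𝔸}
    (hadd : ∀ s t, u (s + t) = u s * u t) (h0 : u 0 = 1) (hu : HasDerivAt u X 0) (z : ℂ) :
    u z = exp (z • X) := by
  let : NormedAlgebra ℚ 𝔸 := .restrictScalars ℚ ℂ 𝔸
  have hd : ∀ z, HasDerivAt u (X * u z) z := by
    intro z
    have h1 : HasDerivAt (fun t => u (t - z)) X z := by
      have : HasDerivAt u X (z - z) := by simpa using hu
      exact this.comp_sub_const z z
    have h2 := h1.mul_const (u z)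
    simpa [← hadd] using h2
  -- `exp (-zX) * u z` is constant, since `u` solves `u' = X u`.
  have hw : ∀ z, HasDerivAt (fun z => exp (z • (-X)) * u z) 0 z := by
    intro z
    have h := (hasDerivAt_exp_smul_const (𝕂 := ℂ) (-X) z).mul (hd z)
    simpa [mul_assoc] using! h
  have hc := is_const_of_deriv_eq_zero (fun z => (hw z).differentiableAt)
    (fun z => (hw z).deriv) z 0
  simp only [zero_smul, exp_zero, h0, mul_one] at hc
  have hn : exp (z • X) * exp (z • (-X)) = 1 := by
    rw [← exp_add_of_commute] <;> simp
  calc u z = exp (z • X) * (exp (z • (-X)) * u z) := by rw [← mul_assoc, hn, one_mul]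
    _ = exp (z • X) := by rw [hc, mul_one]

lemma IsOneParameterSubgroup.map_eq_exp [CompleteSpace 𝔸] {π : G →* 𝔸}
    (hπ : MDifferentiable 𝓘(ℂ, E) 𝓘(ℂ, 𝔸) π) {γ : ℂ → G} {x : GroupLieAlgebra 𝓘(ℂ, E) G}
    (hγ : IsOneParameterSubgroup γ x) (z : ℂ) :
    π (γ z) = exp (z • differentialAtOne E π x) := by
  have h0 : γ 0 = 1 := by simpa using hγ.1 0 0
  refine eq_exp_of_hasDerivAt_zero (u := fun z => π (γ z)) (fun s t => by simp [hγ.1])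
    (by simp [h0]) ?_ z
  have h1 : HasMFDerivAt 𝓘(ℂ, E) 𝓘(ℂ, 𝔸) π (γ 0) (mfderiv 𝓘(ℂ, E) 𝓘(ℂ, 𝔸) π 1) := by
    rw [h0]; exact (hπ 1).hasMFDerivAt
  have h2 : HasFDerivAt (fun z => π (γ z))
      ((show E →L[ℂ] 𝔸 from mfderiv 𝓘(ℂ, E) 𝓘(ℂ, 𝔸) π 1).comp
        (ContinuousLinearMap.toSpanSingleton ℂ (show E from x))) 0 :=
    (h1.comp (0 : ℂ) hγ.2).hasFDerivAt
  have h3 : (ContinuousLinearMap.toSpanSingleton ℂ (show E from x)) 1 = x :=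
    one_smul ℂ (show E from x)
  rw [← mfderiv_one_apply]
  refine HasDerivAt.congr_deriv h2.hasDerivAt ?_
  exact congrArg (mfderiv 𝓘(ℂ, E) 𝓘(ℂ, 𝔸) π 1) h3

end Differential

/-! ### Conjugation of exponentials by exponentials -/

section Exponential

open NormedSpace

variable {𝔸 : Type*} [NormedRing 𝔸] [NormedAlgebra ℂ 𝔸] [CompleteSpace 𝔸]

/-- If `[X, Y] = c Y`, then `exp X exp (b Y) exp (-X) = exp (e^c b Y)`. -/
lemma exp_mul_exp_smul_of_commutator {X Y : 𝔸} {c : ℂ} (h : X * Y - Y * X = c • Y) (b : ℂ) :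
    exp X * exp (b • Y) = exp ((Complex.exp c * b) • Y) * exp X := by
  let : NormedAlgebra ℚ 𝔸 := .restrictScalars ℚ ℂ 𝔸
  -- The commutator relation reads `Y (c + X) = X Y`, a form that survives exponentiation because
  -- `c` is central.
  have h1 : SemiconjBy Y (algebraMap ℂ 𝔸 c + X) X := by
    rw [SemiconjBy, mul_add, ← Algebra.commutes, ← Algebra.smul_def, ← h]; abel
  have h2 := h1.exp_right
  rw [exp_add_of_commute (Algebra.commutes _ _), ← algebraMap_exp_comm,
    ← Complex.exp_eq_exp_ℂ] at h2
  have h3 : SemiconjBy (exp X) (b • Y) ((Complex.exp c * b) • Y) := by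
    have h2' := h2.eq
    rw [← Algebra.smul_def, mul_smul_comm] at h2'
    rw [SemiconjBy, mul_smul_comm, ← h2', smul_mul_assoc, smul_smul, mul_comm]
  exact h3.exp_right.eq

end Exponential

/-! ### Ordered products along a word -/

section OrderedProducts

variable {Q : Type*} [Group Q]

lemma prod_ofFn_telescope {k : ℕ} (P : ℕ → Q) (z : Fin k → Q) :
    (List.ofFn fun j : Fin k => (P j)⁻¹ * z j * P (j + 1)).prod =
      (P 0)⁻¹ * (List.ofFn z).prod * P k := by
  induction k with
  | zero => simp
  | succ k ih =>
    rw [List.ofFn_succ', List.ofFn_succ' z, List.concat_eq_append, List.concat_eq_append,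
      List.prod_append, List.prod_append]
    have := ih fun j => z j.castSucc
    simp only [Fin.val_castSucc, Fin.val_last, List.prod_singleton] at this ⊢
    rw [this]
    group

/-- Each new `x` has to pass only the `y`'s of strictly earlier positions, so nothing is needed
about `x j` and `y j` at the same position. -/
lemma prod_ofFn_mul_prod_ofFn {k : ℕ} (x y : Fin k → Q)
    (h : ∀ m n, m ≠ n → Commute (x m) (y n)) :
    (List.ofFn x).prod * (List.ofFn y).prod = (List.ofFn fun j => x j * y j).prod := by
  induction k with
  | zero => simp
  | succ k ih =>
    rw [List.ofFn_succ', List.ofFn_succ' y, List.ofFn_succ' (fun j => x j * y j),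
      List.concat_eq_append, List.concat_eq_append, List.concat_eq_append,
      List.prod_append, List.prod_append, List.prod_append]
    simp only [List.prod_singleton]
    rw [← ih _ _ fun m n hmn => h _ _ (by simpa using hmn)]
    have hc : Commute (x (Fin.last k)) (List.ofFn fun j : Fin k => y j.castSucc).prod := by
      apply Commute.list_prod_right
      intro g hg
      obtain ⟨j, rfl⟩ := List.mem_ofFn.1 hg
      exact h _ _ (Fin.castSucc_lt_last j).ne'
    simp only [mul_assoc]
    rw [← mul_assoc (x (Fin.last k)), hc.eq, mul_assoc]

variable {r : ℕ}

lemma wordProd_telescope (i : Equiv.Perm (Fin r)) (P : ℕ → Q) (z x : Fin r → Q)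
    (h : ∀ j, x (i j) = (P j)⁻¹ * z (i j) * P (j + 1)) :
    wordProd i x = (P 0)⁻¹ * wordProd i z * P r := by
  unfold wordProd
  simp only [h]
  exact prod_ofFn_telescope P fun j => z (i j)

lemma wordProd_mul_wordProd (i : Equiv.Perm (Fin r)) (x y : Fin r → Q)
    (h : ∀ m n, m ≠ n → Commute (x m) (y n)) :
    wordProd i x * wordProd i y = wordProd i fun n => x n * y n :=
  prod_ofFn_mul_prod_ofFn _ _ fun _ _ hmn => h _ _ (i.injective.ne hmn)

lemma map_wordProd {Q' : Type*} [Group Q'] (f : Q →* Q') (i : Equiv.Perm (Fin r)) (x : Fin r → Q) :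
    f (wordProd i x) = wordProd i fun n => f (x n) := by
  simp [wordProd, map_list_prod, List.map_ofFn, Function.comp_def]

lemma mul_wordProd_of_mul_eq {g : Q} {x y : Fin r → Q} (i : Equiv.Perm (Fin r))
    (h : ∀ n, g * x n = y n * g) : g * wordProd i x = wordProd i y * g := by
  have h1 : wordProd i y = MulAut.conj g (wordProd i x) := by
    rw [← MulEquiv.coe_toMonoidHom, map_wordProd]
    congr 1
    ext n
    simp [h]
  simp [h1]

end OrderedProducts

/-! ### Factorizations in `SL₂` and exponential coordinates -/

section SL2

lemma upperSL_mul_upperSL (a b : ℂ) (u v : ℂˣ) :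
    upperSL u a * upperSL v b = upperSL (u * v) (u * b + a * (v : ℂ)⁻¹) := by
  apply Subtype.ext
  rw [Matrix.SpecialLinearGroup.coe_mul]
  simp [upperSL, mul_comm]

lemma upperSL_eq (u : ℂˣ) (b : ℂ) : upperSL u b = upperSL 1 (b * u) * upperSL u 0 := by
  rw [upperSL_mul_upperSL]; simp

lemma inv_lowerSL (u : ℂˣ) (c : ℂ) :
    (lowerSL u c)⁻¹ = upperSL u⁻¹ 0 * lowerSL 1 (-(c * (u : ℂ)⁻¹)) := by
  rw [inv_eq_iff_mul_eq_one]
  apply Subtype.ext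
  rw [Matrix.SpecialLinearGroup.coe_mul, Matrix.SpecialLinearGroup.coe_mul]
  simp [upperSL, lowerSL, Matrix.one_fin_two]

lemma upperSL_mul_lowerSL (χ : ℂ) : upperSL 1 χ * lowerSL 1 (-1) = gMinus χ := by
  apply Subtype.ext
  rw [Matrix.SpecialLinearGroup.coe_mul]
  simp [upperSL, lowerSL, gMinus, sub_eq_add_neg]

lemma lowerSL_mul_upperSL (χ : ℂ) : lowerSL 1 (-1) * upperSL 1 χ = gPlus χ := by
  apply Subtype.ext
  rw [Matrix.SpecialLinearGroup.coe_mul]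
  simp [upperSL, lowerSL, gPlus, sub_eq_add_neg, add_comm]

lemma exists_expUnit_eq (u : ℂˣ) : ∃ z, expUnit z = u :=
  ⟨Complex.log u, Units.ext (Complex.exp_log u.ne_zero)⟩

lemma exp_sum_intCast_mul {ι : Type*} (s : Finset ι) (k : ι → ℤ) (z : ι → ℂ) :
    Complex.exp (∑ m ∈ s, (k m : ℂ) * z m) = ((∏ m ∈ s, expUnit (z m) ^ k m : ℂˣ) : ℂ) := by
  rw [Complex.exp_sum, Units.coe_prod]
  simp [expUnit, Complex.exp_int_mul]

end SL2

/-! ### From root relations to the trace identities -/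

section Factorization

variable {Q : Type*} [Group Q] {r : ℕ}

/-- The relations between the images of the root subgroups and of the torus of a group with Cartan
matrix `K`: `T s` stands for `exp (∑ n, s n h^n)`. -/
structure RootRelations (K : Matrix (Fin r) (Fin r) ℤ) (ψ : Fin r → SL(2, ℂ) →* Q)
    (T : (Fin r → ℂ) → Q) : Prop where
  torus_add : ∀ s t, T (s + t) = T s * T t
  torus_eq : ∀ n z, ψ n (upperSL (expUnit z) 0) = T fun m => (K n m : ℂ) * z
  torus_upper : ∀ s n b, T s * ψ n (upperSL 1 b) = ψ n (upperSL 1 (Complex.exp (s n) * b)) * T s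
  torus_lower : ∀ s n b, T s * ψ n (lowerSL 1 b) = ψ n (lowerSL 1 (Complex.exp (-s n) * b)) * T s
  commute : ∀ m n, m ≠ n → ∀ b c, Commute (ψ m (upperSL 1 b)) (ψ n (lowerSL 1 c))

namespace RootRelations

variable {K : Matrix (Fin r) (Fin r) ℤ} {ψ : Fin r → SL(2, ℂ) →* Q} {T : (Fin r → ℂ) → Q}

lemma torus_zero (h : RootRelations K ψ T) : T 0 = 1 := by
  simpa using h.torus_add 0 0

lemma torus_neg (h : RootRelations K ψ T) (s : Fin r → ℂ) : T (-s) = (T s)⁻¹ := by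
  rw [eq_inv_iff_mul_eq_one, ← h.torus_add]; simp [h.torus_zero]

lemma torus_comm (h : RootRelations K ψ T) (s t : Fin r → ℂ) : T s * T t = T t * T s := by
  rw [← h.torus_add, add_comm, h.torus_add]

lemma wordProd_upper (h : RootRelations K ψ T) (i : Equiv.Perm (Fin r)) (α : Fin r → ℂ)
    (B : Fin r → ℂˣ) :
    wordProd i (fun n => ψ n (upperSL (expUnit (α n)) (B n))) =
      wordProd i (fun n => ψ n (upperSL 1 (coordV K i (fun m => expUnit (α m)) B n))) *
        T fun n => ∑ m, (K m n : ℂ) * α m := by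
  -- `T (σ j)` is the torus part collected from the first `j` letters. Carrying it across the letter
  -- at position `j` produces the product over `lettersBefore`.
  set σ : ℕ → Fin r → ℂ := fun j n => ∑ m with ((i.symm m : Fin r) : ℕ) < j, (K m n : ℂ) * α m
  have hσ : ∀ j : Fin r, σ (j + 1) = σ j + fun n => (K (i j) n : ℂ) * α (i j) := by
    intro j
    ext n
    have : (Finset.univ.filter fun m => ((i.symm m : Fin r) : ℕ) < j + 1) =
        insert (i j) (Finset.univ.filter fun m => ((i.symm m : Fin r) : ℕ) < j) := by
      ext m
      simp only [Finset.mem_filter, Finset.mem_univ, true_and, Finset.mem_insert,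
        ← Equiv.symm_apply_eq, Fin.ext_iff]
      omega
    simp only [σ, this, Pi.add_apply]
    rw [Finset.sum_insert (by simp), add_comm]
  rw [wordProd_telescope i (fun j => T (σ j))
    (fun n => ψ n (upperSL 1 (coordV K i (fun m => expUnit (α m)) B n)))]
  · have h0 : σ 0 = 0 := by ext; simp [σ]
    have hr : σ r = fun n => ∑ m, (K m n : ℂ) * α m := by ext; simp [σ]
    rw [h0, hr, h.torus_zero]
    simp
  · intro j
    rw [upperSL_eq, map_mul, h.torus_eq, hσ, h.torus_add, ← mul_assoc]
    congr 1
    rw [mul_assoc, eq_inv_mul_iff_mul_eq, h.torus_upper]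
    congr 3
    simp only [σ, exp_sum_intCast_mul, coordV, lettersBefore]
    simp only [Units.val_mul, Equiv.symm_apply_apply, Fin.lt_def]
    ring

lemma wordProd_lower (h : RootRelations K ψ T) (i : Equiv.Perm (Fin r)) (δ : Fin r → ℂ)
    (C : Fin r → ℂˣ) :
    wordProd i (fun n => (ψ n (lowerSL (expUnit (δ n)) (C n)))⁻¹) =
      (T fun n => ∑ m, (K m n : ℂ) * δ m)⁻¹ *
        wordProd i (fun n => ψ n (lowerSL 1 (-coordW K i C (fun m => expUnit (δ m)) n))) := by
  -- Here the torus moves left, so `T (σ j)` collects positions `≥ j`, and the letter at position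
  -- `j` is crossed by the strictly later ones, `σ (j + 1)`.
  set σ : ℕ → Fin r → ℂ := fun j n => ∑ m with j ≤ ((i.symm m : Fin r) : ℕ), (K m n : ℂ) * δ m
  have hσ : ∀ j : Fin r, σ j = (fun n => (K (i j) n : ℂ) * δ (i j)) + σ (j + 1) := by
    intro j
    ext n
    have : (Finset.univ.filter fun m => (j : ℕ) ≤ ((i.symm m : Fin r) : ℕ)) =
        insert (i j) (Finset.univ.filter fun m => j + 1 ≤ ((i.symm m : Fin r) : ℕ)) := by
      ext m
      simp only [Finset.mem_filter, Finset.mem_univ, true_and, Finset.mem_insert,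
        ← Equiv.symm_apply_eq, Fin.ext_iff]
      omega
    simp only [σ, this, Pi.add_apply]
    rw [Finset.sum_insert (by simp)]
  rw [wordProd_telescope i (fun j => T (σ j))
    (fun n => ψ n (lowerSL 1 (-coordW K i C (fun m => expUnit (δ m)) n)))]
  · have h0 : σ r = 0 := by
      ext
      simp only [σ, Pi.zero_apply]
      rw [Finset.filter_false_of_mem fun m _ => (i.symm m).isLt.not_ge, Finset.sum_empty]
    have hr : σ 0 = fun n => ∑ m, (K m n : ℂ) * δ m := by ext; simp [σ]
    rw [h0, hr, h.torus_zero]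
    simp
  · intro j
    have hinv : (expUnit (δ (i j)))⁻¹ = expUnit (-δ (i j)) := by
      ext; simp [expUnit, Complex.exp_neg]
    have hneg : (fun m => (K (i j) m : ℂ) * -δ (i j)) = -fun m => (K (i j) m : ℂ) * δ (i j) := by
      ext; simp
    rw [← map_inv, inv_lowerSL, map_mul, hinv, h.torus_eq, hneg, h.torus_neg, hσ j, h.torus_add,
      h.torus_comm, mul_inv_rev, mul_assoc, mul_assoc]
    congr 1
    rw [eq_inv_mul_iff_mul_eq, h.torus_lower]
    congr 3
    simp only [σ, coordW, lettersAfter, ← Finset.sum_neg_distrib, ← neg_mul, ← Int.cast_neg]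
    rw [exp_sum_intCast_mul]
    simp only [Units.val_mul, Equiv.symm_apply_apply, Fin.lt_def, Nat.succ_le_iff]
    simp
    ring

lemma class_function_coxeterElement (h : RootRelations K ψ T) {R : Type*} (tr : Q → R)
    (htr : ∀ x y, tr (x * y) = tr (y * x)) (i : Equiv.Perm (Fin r)) (A B C D : Fin r → ℂˣ)
    (a t : Fin r → ℂ) (ha : ∀ m, Complex.exp (a m) = (A m : ℂ) / (D m : ℂ))
    (ht : ∀ n, t n = ∑ m, (K m n : ℂ) * a m) :
    (∀ n, (chiMinus K i A B C D n : ℂ) = Complex.exp (-t n) * chiPlus K i A B C D n) ∧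
    tr (coxeterElement ψ i A B C D) =
      tr (T t * wordProd i fun n => ψ n (gMinus (chiMinus K i A B C D n))) ∧
    tr (coxeterElement ψ i A B C D) =
      tr (T t * wordProd i fun n => ψ n (gPlus (chiPlus K i A B C D n))) := by
  have hau : ∀ m, expUnit (a m) = A m / D m := fun m => Units.ext (by simp [expUnit, ha])
  -- Any logarithm of `D` will do, but that of `A` must then be `a + δ`: `T` depends on logarithms,
  -- not only on their exponentials, and the difference has to give `T t` for the prescribed `t`.
  choose δ hδ using fun m => exists_expUnit_eq (D m)
  have hα : ∀ m, expUnit (a m + δ m) = A m := by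
    intro m
    have h1 : expUnit (a m + δ m) = expUnit (a m) * expUnit (δ m) :=
      Units.ext (Complex.exp_add _ _)
    rw [h1, hau, hδ]; simp
  have hchi : ∀ n, (chiMinus K i A B C D n : ℂ) = Complex.exp (-t n) * chiPlus K i A B C D n := by
    intro n
    simp only [ht, ← Finset.sum_neg_distrib, ← neg_mul, ← Int.cast_neg, exp_sum_intCast_mul, hau]
    rw [chiMinus, Units.val_mul, mul_comm]
  set V := coordV K i A B
  set W := coordW K i C D
  -- Since `T u` scales the `n`-th root element by `exp (u n)`, with independent entries, it can
  -- normalise every `-W n` to `-1` at once.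
  choose u hu using fun n => exists_expUnit_eq (W n)
  have hu' : ∀ n, Complex.exp (u n) = W n := fun n => by rw [← hu]; rfl
  have hW : ∀ n, Complex.exp (-u n) * -(W n : ℂ) = -1 := fun n => by
    rw [Complex.exp_neg, hu']; simp
  -- The torus is commutative, so conjugation by `T u` fixes `T t` and only changes the second
  -- factor.
  have hconj : ∀ x y, T u * x = y * T u → tr (T t * x) = tr (T t * y) := by
    intro x y hxy
    rw [← mul_inv_eq_iff_eq_mul] at hxy
    rw [← hxy, mul_assoc, ← mul_assoc (T t), h.torus_comm t u, htr _ (_ * (T u)⁻¹)]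
    rw [htr]
    congr 1
    group
  have hU := h.wordProd_upper i (fun m => a m + δ m) B
  have hL := h.wordProd_lower i δ C
  simp only [hα, hδ] at hU hL
  have hT : (T fun n => ∑ m, (K m n : ℂ) * (a m + δ m)) *
      (T fun n => ∑ m, (K m n : ℂ) * δ m)⁻¹ = T t := by
    rw [← h.torus_neg, ← h.torus_add]
    congr 1
    ext n
    simp [ht, mul_add, Finset.sum_add_distrib]
  have hcox : coxeterElement ψ i A B C D =
      wordProd i (fun n => ψ n (upperSL 1 (V n))) * T t *
        wordProd i (fun n => ψ n (lowerSL 1 (-W n))) := by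
    rw [coxeterElement, hU, hL, ← hT]
    simp only [mul_assoc]
    rfl
  refine ⟨hchi, ?_, ?_⟩
  · have hE : T t * wordProd i (fun n => ψ n (upperSL 1 (Complex.exp (-t n) * V n))) =
        wordProd i (fun n => ψ n (upperSL 1 (V n))) * T t := by
      apply mul_wordProd_of_mul_eq
      intro n
      rw [h.torus_upper, ← mul_assoc, ← Complex.exp_add]
      simp
    rw [hcox, ← hE, mul_assoc, wordProd_mul_wordProd _ _ _ fun m n hmn => h.commute m n hmn _ _]
    apply hconj
    apply mul_wordProd_of_mul_eq
    intro n
    rw [← mul_assoc, h.torus_upper, mul_assoc, h.torus_lower, hW, ← mul_assoc, ← map_mul,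
      ← upperSL_mul_lowerSL, hchi, hu']
    congr 4
    simp only [chiPlus, Units.val_mul, V, W]
    ring
  · rw [hcox, mul_assoc, htr, mul_assoc,
      wordProd_mul_wordProd _ _ _ fun m n hmn => (h.commute n m hmn.symm _ _).symm]
    apply hconj
    apply mul_wordProd_of_mul_eq
    intro n
    rw [← mul_assoc, h.torus_lower, mul_assoc, h.torus_upper, hW, ← mul_assoc, ← map_mul,
      ← lowerSL_mul_upperSL, hu']
    congr 4
    simp only [chiPlus, Units.val_mul, V, W]
    ring

end RootRelations

end Factorization

/-! ### Fundamental coweights -/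

section LieAlgebra

variable {L : Type*} [LieRing L] [LieAlgebra ℂ L] {H : LieSubalgebra ℂ L} {r : ℕ}
  (b : LieAlgebra.Basis (Fin r) H)

lemma isUnit_det_cartanMat_map : IsUnit ((cartanMat b).map (Int.cast : ℤ → ℂ)).det := by
  have h1 : b.A.det ≠ 0 := Matrix.nondegenerate_iff_det_ne_zero.1 b.nondegen
  have h2 : ((cartanMat b).map (Int.cast : ℤ → ℂ)).det = ((cartanMat b).det : ℂ) :=
    (Int.cast_det (cartanMat b)).symm
  rw [h2, cartanMat, Matrix.det_transpose, isUnit_iff_ne_zero]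
  exact_mod_cast h1

lemma lie_h_e_eq (m n : Fin r) : ⁅b.h m, b.e n⁆ = (cartanMat b m n : ℂ) • b.e n := by
  rw [b.lie_h_e, cartanMat, Matrix.transpose_apply, Int.cast_smul_eq_zsmul]

lemma lie_h_f_eq (m n : Fin r) : ⁅b.h m, b.f n⁆ = -(cartanMat b m n : ℂ) • b.f n := by
  rw [b.lie_h_f, cartanMat, Matrix.transpose_apply, ← Int.cast_neg, Int.cast_smul_eq_zsmul]

lemma sum_smul_fundCoweight (m : Fin r) :
    ∑ n, (cartanMat b m n : ℂ) • fundCoweight b n = b.h m := by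
  have h := Matrix.mul_nonsing_inv _ (isUnit_det_cartanMat_map b)
  simp only [fundCoweight, Finset.smul_sum, smul_smul]
  rw [Finset.sum_comm]
  simp only [← Finset.sum_smul]
  have h1 : ∀ p, ∑ n, (cartanMat b m n : ℂ) * ((cartanMat b).map (Int.cast : ℤ → ℂ))⁻¹ n p =
      (1 : Matrix (Fin r) (Fin r) ℂ) m p := by
    intro p
    rw [← h, Matrix.mul_apply]
    simp
  simp [h1, Matrix.one_apply]

lemma sum_inv_cartanMat_mul (m n : Fin r) :
    ∑ p, ((cartanMat b).map (Int.cast : ℤ → ℂ))⁻¹ m p * (cartanMat b p n : ℂ) =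
      if m = n then 1 else 0 := by
  rw [← Matrix.one_apply, ← Matrix.nonsing_inv_mul _ (isUnit_det_cartanMat_map b),
    Matrix.mul_apply]
  simp

/-- The coweights are dual to the simple roots because the inverse Cartan matrix cancels the weights
`K p n`. -/
lemma lie_fundCoweight_e (m n : Fin r) :
    ⁅fundCoweight b m, b.e n⁆ = (if m = n then (1 : ℂ) else 0) • b.e n := by
  simp only [fundCoweight, sum_lie, smul_lie, lie_h_e_eq, smul_smul, ← Finset.sum_smul,
    sum_inv_cartanMat_mul]

lemma lie_fundCoweight_f (m n : Fin r) :
    ⁅fundCoweight b m, b.f n⁆ = -(if m = n then (1 : ℂ) else 0) • b.f n := by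
  simp only [fundCoweight, sum_lie, smul_lie, lie_h_f_eq, smul_smul, mul_neg, ← Finset.sum_smul,
    Finset.sum_neg_distrib, sum_inv_cartanMat_mul]

lemma lie_fundCoweight_fundCoweight (m n : Fin r) : ⁅fundCoweight b m, fundCoweight b n⁆ = 0 := by
  simp [fundCoweight, sum_lie, lie_sum, b.lie_h_h]

end LieAlgebra

/-! ### Root relations in a representation -/

section Representation

open NormedSpace

lemma prod_ofFn_exp {𝔸 : Type*} [NormedRing 𝔸] [NormedAlgebra ℂ 𝔸] [CompleteSpace 𝔸] {k : ℕ}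
    (x : Fin k → 𝔸) (h : ∀ m n, Commute (x m) (x n)) :
    (List.ofFn fun j => exp (x j)).prod = exp (∑ j, x j) := by
  let : NormedAlgebra ℚ 𝔸 := .restrictScalars ℚ ℂ 𝔸
  induction k with
  | zero => simp
  | succ k ih =>
    rw [List.ofFn_succ, List.prod_cons, ih _ fun m n => h _ _, Fin.sum_univ_succ,
      exp_add_of_commute (Commute.sum_right _ _ _ fun j _ => h _ _)]

variable {E : Type*} [NormedAddCommGroup E] [NormedSpace ℂ E] [CompleteSpace E]
  {G : Type*} [TopologicalSpace G] [ChartedSpace E G] [Group G] [LieGroup 𝓘(ℂ, E) ω G]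
  {r : ℕ} {H : LieSubalgebra ℂ (GroupLieAlgebra 𝓘(ℂ, E) G)}
  {𝔸 : Type*} [NormedRing 𝔸] [NormedAlgebra ℂ 𝔸] [CompleteSpace 𝔸]

lemma rootRelations_toHomUnits (b : LieAlgebra.Basis (Fin r) H)
    {φ : Fin r → SL(2, ℂ) →* G} (hφ : ∀ n, IsSL2Hom (φ n) (b.h n) (b.e n) (b.f n))
    {τ : Fin r → ℂ → G} (hτ : ∀ n, IsOneParameterSubgroup (τ n) (fundCoweight b n))
    {π : G →* 𝔸} (hπ : ContMDiff 𝓘(ℂ, E) 𝓘(ℂ, 𝔸) ω π) :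
    RootRelations (cartanMat b) (fun n => π.toHomUnits.comp (φ n))
      (fun s => π.toHomUnits (List.ofFn fun n => τ n (s n)).prod) := by
  let : NormedAlgebra ℚ 𝔸 := .restrictScalars ℚ ℂ 𝔸
  have hd := hπ.mdifferentiable (by simp)
  set X : Fin r → 𝔸 := fun n => differentialAtOne E π (fundCoweight b n) with hX
  have hcomm : ∀ m n, Commute (X m) (X n) := by
    intro m n
    have := differentialAtOne_lie hπ (fundCoweight b m) (fundCoweight b n)
    rw [lie_fundCoweight_fundCoweight, map_zero] at this
    exact sub_eq_zero.1 this.symm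
  have hT : ∀ s : Fin r → ℂ, π (List.ofFn fun n => τ n (s n)).prod = exp (∑ n, s n • X n) := by
    intro s
    rw [← prod_ofFn_exp _ fun m n => ((hcomm m n).smul_left _).smul_right _, map_list_prod,
      List.map_ofFn]
    congr 2
    ext n
    exact (hτ n).map_eq_exp hd (s n)
  -- The sign `ε` is `1` for the `e_n` and `-1` for the `f_n`.
  have hbr : ∀ (ε : ℂ) (y : Fin r → GroupLieAlgebra 𝓘(ℂ, E) G),
      (∀ m n, ⁅fundCoweight b m, y n⁆ = (ε * if m = n then (1 : ℂ) else 0) • y n) →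
      ∀ (s : Fin r → ℂ) n, (∑ m, s m • X m) * differentialAtOne E π (y n) -
        differentialAtOne E π (y n) * (∑ m, s m • X m) =
          (ε * s n) • differentialAtOne E π (y n) := by
    intro ε y hy s n
    have h1 : ∑ m, s m • X m = differentialAtOne E π (∑ m, s m • fundCoweight b m) := by
      simp [hX]
    rw [h1, ← differentialAtOne_lie hπ, sum_lie]
    simp only [smul_lie, hy, smul_smul, ← Finset.sum_smul, map_smul]
    congr 1
    simp [mul_comm]
  refine ⟨?_, ?_, ?_, ?_, ?_⟩
  · intro s t
    ext
    simp only [MonoidHom.coe_toHomUnits, Units.val_mul, hT]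
    rw [← exp_add_of_commute]
    · simp [add_smul, Finset.sum_add_distrib]
    · exact Commute.sum_left _ _ _ fun m _ => Commute.sum_right _ _ _ fun n _ =>
        ((hcomm m n).smul_left _).smul_right _
  · intro n z
    ext
    simp only [MonoidHom.coe_toHomUnits, MonoidHom.comp_apply, hT]
    rw [(hφ n).map_h.map_eq_exp hd, ← sum_smul_fundCoweight b n, map_sum, Finset.smul_sum]
    simp [hX, smul_smul, mul_comm]
  · intro s n c
    ext
    simp only [MonoidHom.coe_toHomUnits, MonoidHom.comp_apply, Units.val_mul, hT]
    rw [(hφ n).map_e.map_eq_exp hd, (hφ n).map_e.map_eq_exp hd,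
      exp_mul_exp_smul_of_commutator (c := s n)]
    simpa using hbr 1 b.e (fun m n => by rw [lie_fundCoweight_e, one_mul]) s n
  · intro s n c
    ext
    simp only [MonoidHom.coe_toHomUnits, MonoidHom.comp_apply, Units.val_mul, hT]
    rw [(hφ n).map_f.map_eq_exp hd, (hφ n).map_f.map_eq_exp hd,
      exp_mul_exp_smul_of_commutator (c := -s n)]
    simpa using hbr (-1) b.f (fun m n => by rw [lie_fundCoweight_f, neg_one_mul]) s n
  · intro m n hmn c d
    ext
    simp only [MonoidHom.coe_toHomUnits, MonoidHom.comp_apply, Units.val_mul]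
    rw [(hφ m).map_e.map_eq_exp hd, (hφ n).map_f.map_eq_exp hd]
    have := differentialAtOne_lie hπ (b.e m) (b.f n)
    rw [b.lie_e_f_ne m n hmn, map_zero] at this
    have hc : Commute (differentialAtOne E π (b.e m)) (differentialAtOne E π (b.f n)) :=
      sub_eq_zero.1 this.symm
    exact (((hc.smul_left _).smul_right _).exp).eq

lemma map_coxeterElement {G Q : Type*} [Group G] [Group Q] (f : G →* Q) {r : ℕ}
    (φ : Fin r → SL(2, ℂ) →* G)
    (i : Equiv.Perm (Fin r)) (A B C D : Fin r → ℂˣ) :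
    f (coxeterElement φ i A B C D) = coxeterElement (fun n => f.comp (φ n)) i A B C D := by
  simp [coxeterElement, map_wordProd]

end Representation

/-! ### From holomorphic matrix coefficients to holomorphic operator-valued maps -/

section Holomorphic

variable {E : Type*} [NormedAddCommGroup E] [NormedSpace ℂ E]
  {G : Type*} [TopologicalSpace G] [ChartedSpace E G] [Group G]

/-- Expanded in matrix units, `ρ g` is a finite sum of constant operators with matrix coefficients
as scalars. -/
lemma IsHolomorphicRep.contMDiff_linearMap_comp {V : Type*} [AddCommGroup V] [Module ℂ V]
    [FiniteDimensional ℂ V] {F : Type*} [NormedAddCommGroup F] [NormedSpace ℂ F]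
    (Θ : (V →ₗ[ℂ] V) →ₗ[ℂ] F) {ρ : Representation ℂ G V} (hρ : IsHolomorphicRep E ρ) :
    ContMDiff 𝓘(ℂ, E) 𝓘(ℂ, F) ω fun g => Θ (ρ g) := by
  set v := Module.finBasis ℂ V
  have h : ∀ f : V →ₗ[ℂ] V,
      f = ∑ q, ∑ p, v.coord p (f (v q)) • (v.coord q).smulRight (v p) := by
    intro f
    refine v.ext fun q => ?_
    simp [Finsupp.single_apply, v.sum_repr]
  have hΘ : (fun g => Θ (ρ g)) =
      fun g => ∑ q, ∑ p, v.coord p (ρ g (v q)) • Θ ((v.coord q).smulRight (v p)) := by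
    ext1 g
    conv_lhs => rw [h (ρ g)]
    simp only [map_sum, map_smul]
  rw [hΘ]
  exact ContMDiff.sum fun q _ => ContMDiff.sum fun p _ =>
    (hρ (v q) (v.coord p)).smul contMDiff_const

end Holomorphic

end CoxeterToda

end

/-! ### The character identities -/

open CoxeterToda in
theorem mainTheorem6
    -- a connected simple complex Lie group, with Chevalley generators of its Lie algebra
    {E : Type*} [NormedAddCommGroup E] [NormedSpace ℂ E] [FiniteDimensional ℂ E] [CompleteSpace E]
    {G : Type*} [TopologicalSpace G] [ChartedSpace E G] [Group G] [LieGroup 𝓘(ℂ, E) ω G]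
    [ConnectedSpace G] [LieAlgebra.IsSimple ℂ (GroupLieAlgebra 𝓘(ℂ, E) G)]
    {r : ℕ} {H : LieSubalgebra ℂ (GroupLieAlgebra 𝓘(ℂ, E) G)} (b : LieAlgebra.Basis (Fin r) H)
    -- the homomorphisms `φ_n : SL₂ → G` of the simple roots
    (φ : Fin r → SL(2, ℂ) →* G) (hφ : ∀ n, IsSL2Hom (φ n) (b.h n) (b.e n) (b.f n))
    -- the one-parameter subgroups `τ_n z = exp (z h^n)`
    (τ : Fin r → ℂ → G) (hτ : ∀ n, IsOneParameterSubgroup (τ n) (fundCoweight b n))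
    -- a Coxeter word and a point of the corresponding chart
    (i : Equiv.Perm (Fin r)) (A B C D : Fin r → ℂˣ)
    -- logarithms `t_n` of `χ⁺_n / χ⁻_n = ∏_m (A_m / D_m) ^ K m n`
    (a t : Fin r → ℂ) (ha : ∀ m, Complex.exp (a m) = (A m : ℂ) / (D m : ℂ))
    (ht : ∀ n, t n = ∑ m, (cartanMat b m n : ℂ) * a m)
    {V : Type*} [AddCommGroup V] [Module ℂ V] [FiniteDimensional ℂ V]
    (ρ : Representation ℂ G V) (hρ : IsHolomorphicRep E ρ) :
    (∀ n, Complex.exp (t n) = (chiPlus (cartanMat b) i A B C D n : ℂ) /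
      (chiMinus (cartanMat b) i A B C D n : ℂ)) ∧
    ρ.character (coxeterElement φ i A B C D) =
      ρ.character ((List.ofFn fun n => τ n (t n)).prod *
        wordProd i fun n => φ n (gMinus (chiMinus (cartanMat b) i A B C D n))) ∧
    ρ.character (coxeterElement φ i A B C D) =
      ρ.character ((List.ofFn fun n => τ n (t n)).prod *
        wordProd i fun n => φ n (gPlus (chiPlus (cartanMat b) i A B C D n))) := by
  let d := Module.finrank ℂ V
  -- `V` carries no norm; coordinates turn its endomorphisms into a Banach algebra, and traces are
  -- taken after going back through `Θ.symm`.
  let Θ : (V →ₗ[ℂ] V) ≃ₐ[ℂ] ((Fin d → ℂ) →L[ℂ] (Fin d → ℂ)) :=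
    ((Module.finBasis ℂ V).equivFun.conjAlgEquiv ℂ).trans (Module.End.toContinuousLinearMap _)
  let π : G →* ((Fin d → ℂ) →L[ℂ] (Fin d → ℂ)) := (Θ : (V →ₗ[ℂ] V) →* _).comp ρ
  have hπ : ContMDiff 𝓘(ℂ, E) 𝓘(ℂ, (Fin d → ℂ) →L[ℂ] (Fin d → ℂ)) ω π :=
    hρ.contMDiff_linearMap_comp Θ.toLinearMap
  have hchar : ∀ g, LinearMap.trace ℂ V (Θ.symm (π.toHomUnits g)) = ρ.character g := fun g =>
    congrArg (LinearMap.trace ℂ V) (Θ.symm_apply_apply (ρ g))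
  obtain ⟨h1, h2, h3⟩ := (rootRelations_toHomUnits b hφ hτ hπ).class_function_coxeterElement
    (fun q => LinearMap.trace ℂ V (Θ.symm q))
    (fun x y => by simp only [Units.val_mul, map_mul, LinearMap.trace_mul_comm]) i A B C D a t ha ht
  simp only [← map_coxeterElement, MonoidHom.comp_apply, ← map_wordProd, ← map_mul, hchar] at h2 h3
  refine ⟨fun n => ?_, h2, h3⟩
  rw [h1, Complex.exp_neg, eq_div_iff (by simp [Complex.exp_ne_zero]), ← mul_assoc,
    mul_inv_cancel₀ (Complex.exp_ne_zero _), one_mul]
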